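/- By a graph we mean a set of vertices with a symmetric binary relation, not necessarily irreflexive (so self-loops are allowed). For a structure $N$ with a binary relation $\in^N$, the D-graph (double-membership graph) $N_1$ of $N$ is the graph with vertex set $N$ in which $x,y$ are adjacent if and only if $N\models x\in y\wedge y\in x$. For a model $M$ of $\mathsf{ZFC}$, a graph in $M$ consists of elements $V,E\in M$ such that $M\models$ "$E\subseteq V\times V$ is a symmetric relation on $V$" (with Kuratowski pairs); it is identified with the graph whose vertices are the $x\in M$ with $M\models x\in V$, and in which $x,y$ are adjacent if and only if $M\models (x,y)\in E$. Proposition. Let $M\models\mathsf{ZFC}$ and let $G$ be a graph in $M$. Then there is a model $N$ of $\mathsf{ZFC}$ without Foundation (that is, of the axioms of $\mathsf{ZFC}$ other than the Axiom of Foundation) such that $N_1$ is isomorphic to the disjoint union of $G$ with infinitely many isolated vertices, i.e. points without any edges or self-loops. -/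

import Mathlib

open FirstOrder FirstOrder.Language

universe u

namespace DoubleMembership

/-! ## The language of set theory and the axioms of ZFC -/

/-- The relation symbols of the language of set theory: one binary symbol. -/
inductive SetRel : ℕ → Type
  | mem : SetRel 2

/-- The first-order language of set theory, whose only symbol is the binary relation `∈`. -/
def setLang : FirstOrder.Language.{0, 0} := ⟨fun _ => Empty, SetRel⟩

/-- The symbol `∈`. -/
abbrev memSymb : setLang.Relations 2 := SetRel.mem

/-! Sentences are written with de Bruijn levels: the outermost quantifier binds variable `0`, the
next one variable `1`, and so on. -/

/-- The atomic formula `xᵢ ∈ xⱼ`. -/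
abbrev memF {n : ℕ} (i j : Fin n) : setLang.BoundedFormula Empty n :=
  memSymb.boundedFormula₂ (Term.var (Sum.inr i)) (Term.var (Sum.inr j))

/-- The atomic formula `xᵢ = xⱼ`. -/
abbrev eqF {n : ℕ} (i j : Fin n) : setLang.BoundedFormula Empty n :=
  Term.bdEqual (Term.var (Sum.inr i)) (Term.var (Sum.inr j))

/-- `∀ x y, (∀ z, z ∈ x ↔ z ∈ y) → x = y`. -/
def extensionality : setLang.Sentence :=
  ∀' ∀' ((∀' (memF 2 0 ⇔ memF 2 1)) ⟹ eqF 0 1)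

/-- `∀ a, (∃ x, x ∈ a) → ∃ x, x ∈ a ∧ ∀ y, y ∈ x → y ∉ a`. -/
def foundation : setLang.Sentence :=
  ∀' ((∃' memF 1 0) ⟹ ∃' (memF 1 0 ⊓ ∀' (memF 2 1 ⟹ ∼(memF 2 0))))

/-- `∀ x y, ∃ p, ∀ z, z ∈ p ↔ z = x ∨ z = y`. -/
def pairing : setLang.Sentence :=
  ∀' ∀' ∃' ∀' (memF 3 2 ⇔ (eqF 3 0 ⊔ eqF 3 1))

/-- `∀ a, ∃ u, ∀ x, x ∈ u ↔ ∃ y, y ∈ a ∧ x ∈ y`. -/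
def union : setLang.Sentence :=
  ∀' ∃' ∀' (memF 2 1 ⇔ ∃' (memF 3 0 ⊓ memF 2 3))

/-- `∀ a, ∃ p, ∀ x, x ∈ p ↔ ∀ y, y ∈ x → y ∈ a`. -/
def powerSet : setLang.Sentence :=
  ∀' ∃' ∀' (memF 2 1 ⇔ ∀' (memF 3 2 ⟹ memF 3 0))

/-- `∃ a, (∃ e, e ∈ a ∧ ∀ x, x ∉ e) ∧ ∀ x, x ∈ a → ∃ y, y ∈ a ∧ ∀ z, z ∈ y ↔ z ∈ x ∨ z = x`. -/
def infinity : setLang.Sentence :=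
  ∃' ((∃' (memF 1 0 ⊓ ∀' ∼(memF 2 1))) ⊓
    ∀' (memF 1 0 ⟹ ∃' (memF 2 0 ⊓ ∀' (memF 3 2 ⇔ (memF 3 1 ⊔ eqF 3 1)))))

/-- Every set `a` of non-empty, pairwise disjoint sets has a transversal `c`:
`∀ a, (∀ x, x ∈ a → ∃ y, y ∈ x) ∧
  (∀ x y, x ∈ a ∧ y ∈ a ∧ (∃ z, z ∈ x ∧ z ∈ y) → x = y) →
  ∃ c, ∀ x, x ∈ a → ∃ z, ∀ w, (w ∈ c ∧ w ∈ x) ↔ w = z`. -/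
def choice : setLang.Sentence :=
  ∀' (((∀' (memF 1 0 ⟹ ∃' memF 2 1)) ⊓
      (∀' ∀' ((memF 1 0 ⊓ memF 2 0 ⊓ ∃' (memF 3 1 ⊓ memF 3 2)) ⟹ eqF 1 2))) ⟹
    ∃' ∀' (memF 2 0 ⟹ ∃' ∀' ((memF 4 1 ⊓ memF 4 2) ⇔ eqF 4 3)))

/-- For a formula `φ` with parameters `p₀, …, pₙ₋₁` and `k` further free variables, the formula
`φ` in which `pᵢ` is read as the bound variable `i` and the `j`-th further variable is read as the
bound variable `e j`. -/
def plug {n k m : ℕ} (φ : setLang.Formula (Fin n ⊕ Fin k)) (e : Fin k → Fin (n + m)) :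
    setLang.BoundedFormula Empty (n + m) :=
  BoundedFormula.relabel (k := 0)
    (Sum.elim (fun i => Sum.inr (Fin.castAdd m i)) (fun j => Sum.inr (e j)) :
      Fin n ⊕ Fin k → Empty ⊕ Fin (n + m)) φ

/-- After the parameters `p₀, …, pₙ₋₁`, which are the bound variables `0, …, n - 1`, the `i`-th
bound variable counted from `0`, where `m` variables are bound after the parameters. -/
abbrev bv (n m : ℕ) (i : Fin m) : Fin (n + m) := Fin.natAdd n i

/-- The instance of the Separation schema given by a formula `φ(p₀, …, pₙ₋₁, x)`:
`∀ p₀ … pₙ₋₁ a, ∃ b, ∀ x, x ∈ b ↔ x ∈ a ∧ φ(p, x)`. -/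
def separation {n : ℕ} (φ : setLang.Formula (Fin n ⊕ Fin 1)) : setLang.Sentence :=
  BoundedFormula.alls (n := n + 1)
    (∃' ∀' (memF (bv n 3 2) (bv n 3 1) ⇔
      (memF (bv n 3 2) (bv n 3 0) ⊓ plug (m := 3) φ ![bv n 3 2])))

/-- The instance of the Replacement schema given by a formula `φ(p₀, …, pₙ₋₁, x, y)`:
`∀ p₀ … pₙ₋₁ a, (∀ x y z, x ∈ a ∧ φ(p, x, y) ∧ φ(p, x, z) → y = z) →
  ∃ b, ∀ y, y ∈ b ↔ ∃ x, x ∈ a ∧ φ(p, x, y)`. -/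
def replacement {n : ℕ} (φ : setLang.Formula (Fin n ⊕ Fin 2)) : setLang.Sentence :=
  BoundedFormula.alls (n := n + 1)
    ((∀' ∀' ∀' ((memF (bv n 4 1) (bv n 4 0) ⊓ plug (m := 4) φ ![bv n 4 1, bv n 4 2] ⊓
        plug (m := 4) φ ![bv n 4 1, bv n 4 3]) ⟹ eqF (bv n 4 2) (bv n 4 3))) ⟹
      ∃' ∀' (memF (bv n 3 2) (bv n 3 1) ⇔
        ∃' (memF (bv n 4 3) (bv n 4 0) ⊓ plug (m := 4) φ ![bv n 4 3, bv n 4 2])))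

/-- The theory obtained from ZFC by dropping the Axiom of Foundation. -/
def ZFCWithoutFoundation : setLang.Theory :=
  {extensionality, pairing, union, powerSet, infinity, choice} ∪
    {σ | ∃ (n : ℕ) (φ : setLang.Formula (Fin n ⊕ Fin 1)), σ = separation φ} ∪
    {σ | ∃ (n : ℕ) (φ : setLang.Formula (Fin n ⊕ Fin 2)), σ = replacement φ}

/-- The theory ZFC. -/
def ZFC : setLang.Theory := insert foundation ZFCWithoutFoundation

/-! ## Graphs, double-membership graphs, and graphs in a model -/

/-- A graph: a set with a symmetric binary relation, which need not be irreflexive. -/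
structure LoopGraph (V : Type u) where
  Adj : V → V → Prop
  symm : ∀ x y, Adj x y → Adj y x

/-- The disjoint union of a graph with a set `I` of isolated vertices
(no edges at them, no self-loops). -/
def LoopGraph.addIsolated {V : Type u} (G : LoopGraph V) (I : Type u) : LoopGraph (V ⊕ I) where
  Adj := Sum.LiftRel G.Adj (fun _ _ => False)
  symm := by
    rintro _ _ (h | h)
    · exact .inl (G.symm _ _ h)
    · exact h.elim

/-- Isomorphism of graphs. -/
def LoopGraph.Iso {V W : Type u} (G : LoopGraph V) (H : LoopGraph W) : Prop :=
  Nonempty (RelIso G.Adj H.Adj)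

section Model

variable {M : Type u} [setLang.Structure M]

/-- `M ⊨ x ∈ y`. -/
def Mem (x y : M) : Prop := Structure.RelMap memSymb ![x, y]

variable (M) in
/-- The double-membership graph (D-graph) of an `∈`-structure `M`: its vertices are the elements of
`M`, and `x`, `y` are adjacent iff `M ⊨ x ∈ y ∧ y ∈ x`. -/
def dGraph : LoopGraph M where
  Adj x y := Mem x y ∧ Mem y x
  symm _ _ h := ⟨h.2, h.1⟩

/-- `M ⊨ s = {x, y}`. -/
def IsPair (s x y : M) : Prop := ∀ z, Mem z s ↔ z = x ∨ z = y

/-- `M ⊨ p = (x, y)`, where `(x, y) = {{x}, {x, y}}` is the Kuratowski pair. -/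
def IsOrderedPair (p x y : M) : Prop := ∀ z, Mem z p ↔ IsPair z x x ∨ IsPair z x y

variable (M) in
/-- A graph in the sense of `M`: elements `dom` and `edges` of `M` such that, in `M`, `edges` is a
symmetric subset of `dom × dom`. -/
structure InternalGraph where
  dom : M
  edges : M
  edges_subset : ∀ p, Mem p edges → ∃ x y, Mem x dom ∧ Mem y dom ∧ IsOrderedPair p x y
  edges_symm : ∀ x y, (∃ p, Mem p edges ∧ IsOrderedPair p x y) →
    ∃ q, Mem q edges ∧ IsOrderedPair q y x

/-- The actual graph given by a graph in the sense of `M`: its vertices are the `x` with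
`M ⊨ x ∈ dom`, and `x`, `y` are adjacent iff `M ⊨ (x, y) ∈ edges`. -/
def InternalGraph.toGraph (G : InternalGraph M) : LoopGraph {x : M // Mem x G.dom} where
  Adj x y := ∃ p, Mem p G.edges ∧ IsOrderedPair p x.1 y.1
  symm x y := G.edges_symm x.1 y.1

end Model

end DoubleMembership

namespace DoubleMembership

/-! ### Semantics of the axioms -/

section Semantics

variable {M : Type u} [setLang.Structure M]

/-! The proof is a Rieger–Bernays permutation argument. Keep the universe `M` and set `x ∈' y` iff
`x ∈ π y`, where `π` is a definable involution. The twisted structure satisfies every axiom except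
perhaps Foundation (`SetAxioms.twist`); only Infinity needs more, namely that `π` fixes the elements
of some inductive set.

The involution (`SetAxioms.exists_involution`) codes the graph. Let `V` be the vertex set and `c =
{{V}}`. Code `v ∈ V` by `A v = {c, v}`, and let `π` swap `A v` with `B v = {A w : w ∈ V, w adjacent
to v} ∪ {{{A v}}}`, fixing everything else. Then `A w ∈' A v` iff `A w ∈ B v` iff `w`, `v` are
adjacent. The tag `{{A v}}` makes `B` injective even when vertices have equal neighbourhoods. The
set `c` lies above `V`, so no set with `c` in its transitive closure can belong to `A v`. Any other
double membership would thus yield a finite `∈`-cycle, which Foundation in `M` forbids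
(`SetAxioms.not_transGen_self`), or contradict the shape of `B v`.

Neither `A v` (for `v ∈ V`) nor `B v` is transitive, so `π` fixes all transitive sets, in particular
the members of an inductive set of transitive sets. -/

theorem realize_memF {n : ℕ} (i j : Fin n) (v : Empty → M) (xs : Fin n → M) :
    (memF i j).Realize v xs ↔ Mem (xs i) (xs j) :=
  BoundedFormula.realize_rel₂

theorem realize_eqF {n : ℕ} (i j : Fin n) (v : Empty → M) (xs : Fin n → M) :
    (eqF i j).Realize v xs ↔ xs i = xs j :=
  Iff.rfl

theorem realize_plug {n k m : ℕ} (φ : setLang.Formula (Fin n ⊕ Fin k)) (e : Fin k → Fin (n + m))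
    (v : Empty → M) (xs : Fin (n + m) → M) :
    (plug φ e).Realize v xs ↔ φ.Realize (Sum.elim (xs ∘ Fin.castAdd m) (xs ∘ e)) := by
  unfold plug Formula.Realize
  refine BoundedFormula.realize_relabel.trans (iff_of_eq ?_)
  congr 1
  · ext (i | i) <;> rfl
  · exact Subsingleton.elim _ _

theorem realize_extensionality : M ⊨ extensionality ↔
    ∀ x y : M, (∀ z, Mem z x ↔ Mem z y) → x = y := by
  simp [extensionality, Sentence.Realize, Formula.Realize, Mem, Fin.snoc]

theorem realize_foundation : M ⊨ foundation ↔
    ∀ a : M, (∃ x, Mem x a) → ∃ x, Mem x a ∧ ∀ y, Mem y x → ¬ Mem y a := by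
  simp [foundation, Sentence.Realize, Formula.Realize, Mem, Fin.snoc]

theorem realize_pairing : M ⊨ pairing ↔
    ∀ x y : M, ∃ p, ∀ z, Mem z p ↔ z = x ∨ z = y := by
  simp [pairing, Sentence.Realize, Formula.Realize, Mem, Fin.snoc]

theorem realize_union : M ⊨ union ↔
    ∀ a : M, ∃ b, ∀ x, Mem x b ↔ ∃ y, Mem y a ∧ Mem x y := by
  simp [union, Sentence.Realize, Formula.Realize, Mem, Fin.snoc]

theorem realize_powerSet : M ⊨ powerSet ↔
    ∀ a : M, ∃ b, ∀ x, Mem x b ↔ ∀ y, Mem y x → Mem y a := by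
  simp [powerSet, Sentence.Realize, Formula.Realize, Mem, Fin.snoc]

theorem realize_infinity : M ⊨ infinity ↔
    ∃ a : M, (∃ e, Mem e a ∧ ∀ x, ¬ Mem x e) ∧
      ∀ x, Mem x a → ∃ y, Mem y a ∧ ∀ z, Mem z y ↔ Mem z x ∨ z = x := by
  simp [infinity, Sentence.Realize, Formula.Realize, Mem, Fin.snoc]

theorem realize_choice : M ⊨ choice ↔
    ∀ a : M, (∀ x, Mem x a → ∃ y, Mem y x) →
      (∀ x y, Mem x a → Mem y a → (∃ z, Mem z x ∧ Mem z y) → x = y) →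
      ∃ c, ∀ x, Mem x a → ∃ z, ∀ w, Mem w c ∧ Mem w x ↔ w = z := by
  simp [choice, Sentence.Realize, Formula.Realize, Mem, Fin.snoc]

theorem snoc_append {α : Type*} {n m : ℕ} (p : Fin n → α) (q : Fin m → α) (x : α) :
    (Fin.snoc (Fin.append p q : Fin (n + m) → α) x : Fin (n + m + 1) → α) =
      (Fin.append p (Fin.snoc q x) : Fin (n + (m + 1)) → α) :=
  (Fin.append_snoc p q x).symm

theorem realize_bounded_plug {n k m : ℕ} (φ : setLang.Formula (Fin n ⊕ Fin k))
    (e : Fin k → Fin (n + m)) (v : Empty → M) (p : Fin n → M) (q : Fin m → M) :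
    (plug φ e).Realize v (Fin.append p q) ↔
      φ.Realize (Sum.elim p (Fin.append p q ∘ e)) := by
  rw [realize_plug, iff_iff_eq]
  congr 2
  ext i
  simp

theorem forall_append_one {α : Type*} {n : ℕ} {P : (Fin (n + 1) → α) → Prop} :
    (∀ xs, P xs) ↔ ∀ (p : Fin n → α) (a : α), P (Fin.append p ![a]) := by
  refine ⟨fun h p a => h _, fun h xs => ?_⟩
  have := h (Fin.init xs) (xs (Fin.last n))
  rwa [Fin.append_right_eq_snoc, Matrix.cons_val_zero, Fin.snoc_init_self] at this

theorem comp_vec_one {α β : Type*} (f : α → β) (i : α) : f ∘ ![i] = ![f i] := by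
  ext k; fin_cases k; rfl

theorem comp_vec_two {α β : Type*} (f : α → β) (i j : α) : f ∘ ![i, j] = ![f i, f j] := by
  ext k; fin_cases k <;> rfl

theorem realize_separation {n : ℕ} (φ : setLang.Formula (Fin n ⊕ Fin 1)) : M ⊨ separation φ ↔
    ∀ (p : Fin n → M) (a : M), ∃ b, ∀ x, Mem x b ↔ Mem x a ∧ φ.Realize (Sum.elim p ![x]) := by
  rw [separation, Sentence.Realize, BoundedFormula.realize_alls, forall_append_one]
  simp only [BoundedFormula.realize_ex, BoundedFormula.realize_all, snoc_append,
    BoundedFormula.realize_iff, BoundedFormula.realize_inf, realize_memF, realize_bounded_plug,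
    comp_vec_one, Fin.append_right]
  rfl

theorem realize_replacement {n : ℕ} (φ : setLang.Formula (Fin n ⊕ Fin 2)) : M ⊨ replacement φ ↔
    ∀ (p : Fin n → M) (a : M),
      (∀ x y z, Mem x a → φ.Realize (Sum.elim p ![x, y]) → φ.Realize (Sum.elim p ![x, z]) → y = z) →
      ∃ b, ∀ y, Mem y b ↔ ∃ x, Mem x a ∧ φ.Realize (Sum.elim p ![x, y]) := by
  rw [replacement, Sentence.Realize, BoundedFormula.realize_alls, forall_append_one]
  simp only [BoundedFormula.realize_imp, BoundedFormula.realize_ex, BoundedFormula.realize_all,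
    snoc_append, BoundedFormula.realize_iff, BoundedFormula.realize_inf, realize_memF, realize_eqF,
    realize_bounded_plug, comp_vec_two, Fin.append_right, and_imp]
  rfl

end Semantics

/-! ### Definability with parameters, without syntax -/

/-- The predicates on `n`-tuples that are first-order definable with parameters in the structure
`(M, E)`. -/
inductive Dfn {M : Type u} (E : M → M → Prop) : ∀ {n : ℕ}, ((Fin n → M) → Prop) → Prop
  | false {n : ℕ} : Dfn E (fun _ : Fin n → M => False)
  | eq' {n : ℕ} (s t : M ⊕ Fin n) : Dfn E (fun v => Sum.elim id v s = Sum.elim id v t)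
  | mem' {n : ℕ} (s t : M ⊕ Fin n) : Dfn E (fun v => E (Sum.elim id v s) (Sum.elim id v t))
  | imp {n : ℕ} {P Q : (Fin n → M) → Prop} : Dfn E P → Dfn E Q → Dfn E (fun v => P v → Q v)
  | all' {n : ℕ} {P : (Fin (n + 1) → M) → Prop} :
      Dfn E P → Dfn E (fun v => ∀ x, P (Fin.snoc v x))

section Definability

variable {M : Type u} [setLang.Structure M]

theorem Dfn.exists_formula {n : ℕ} {P : (Fin n → M) → Prop} (h : Dfn Mem P) :
    ∃ φ : setLang.BoundedFormula M n, ∀ v, φ.Realize id v ↔ P v := by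
  induction h with
  | false => exact ⟨⊥, fun _ => Iff.rfl⟩
  | eq' s t => exact ⟨(Term.var s).bdEqual (Term.var t), fun _ => Iff.rfl⟩
  | mem' s t =>
    exact ⟨memSymb.boundedFormula₂ (Term.var s) (Term.var t), fun _ => BoundedFormula.realize_rel₂⟩
  | imp _ _ ih₁ ih₂ =>
    obtain ⟨φ, hφ⟩ := ih₁
    obtain ⟨ψ, hψ⟩ := ih₂
    exact ⟨φ.imp ψ, fun v => imp_congr (hφ v) (hψ v)⟩
  | all' _ ih =>
    obtain ⟨φ, hφ⟩ := ih
    exact ⟨φ.all, fun v => forall_congr' fun x => hφ _⟩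

/-- Only finitely many constants from `M` occur in a formula; enumerating them gives the parameter
tuple required by the schemas. -/
theorem Dfn.exists_formula_params {n : ℕ} {P : (Fin n → M) → Prop} (h : Dfn Mem P) :
    ∃ (k : ℕ) (p : Fin k → M) (φ : setLang.Formula (Fin k ⊕ Fin n)),
      ∀ v, φ.Realize (Sum.elim p v) ↔ P v := by
  classical
  obtain ⟨φ, hφ⟩ := h.exists_formula
  let e := φ.freeVarFinset.equivFin
  refine ⟨_, fun i => (e.symm i : M), (φ.restrictFreeVar e).toFormula, fun v => ?_⟩
  rw [BoundedFormula.realize_toFormula, Sum.elim_comp_inl, Sum.elim_comp_inr, ← hφ]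
  exact BoundedFormula.realize_restrictFreeVar id (by simp)

theorem exists_term_eq {α : Type*} {n : ℕ} (t : setLang.Term (α ⊕ Fin n)) (f : α → M) :
    ∃ s : M ⊕ Fin n, ∀ v, t.realize (Sum.elim f v) = Sum.elim id v s := by
  cases t with
  | var i => exact ⟨i.map f id, fun v => by cases i <;> rfl⟩
  | func g => exact g.elim

theorem dfn_boundedFormula {α : Type*} {n : ℕ} (φ : setLang.BoundedFormula α n) (f : α → M) :
    Dfn Mem (fun v => φ.Realize f v) := by
  induction φ with
  | falsum => exact .false
  | equal s t =>
    obtain ⟨s', hs⟩ := exists_term_eq s f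
    obtain ⟨t', ht⟩ := exists_term_eq t f
    simp only [BoundedFormula.Realize, hs, ht]
    exact .eq' s' t'
  | rel R ts =>
    cases R
    obtain ⟨s', hs⟩ := exists_term_eq (ts 0) f
    obtain ⟨t', ht⟩ := exists_term_eq (ts 1) f
    convert Dfn.mem' (E := Mem) s' t' using 2 with v
    rw [← hs, ← ht, Mem, iff_iff_eq]
    change Structure.RelMap memSymb _ = _
    congr 1
    ext i
    fin_cases i <;> rfl
  | imp _ _ ih₁ ih₂ => exact .imp ih₁ ih₂
  | all _ ih => exact .all' ih

theorem dfn_formula {k n : ℕ} (φ : setLang.Formula (Fin k ⊕ Fin n)) (p : Fin k → M) :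
    Dfn Mem (fun v => φ.Realize (Sum.elim p v)) := by
  -- Relabelling along `id` moves the `Fin n` variables from free to de Bruijn position.
  have h : ∀ v : Fin n → M, (BoundedFormula.relabel (k := 0)
      (id : Fin k ⊕ Fin n → Fin k ⊕ Fin n) φ).Realize p v ↔ φ.Realize (Sum.elim p v) := by
    intro v
    unfold Formula.Realize
    refine BoundedFormula.realize_relabel.trans (iff_of_eq ?_)
    congr 1
    exact Subsingleton.elim _ _
  exact funext (fun v => propext (h v)) ▸ dfn_boundedFormula _ p

end Definability

/-! ### The axioms in semantic form -/

/-- The axioms of ZFC without Foundation for a structure `(M, E)`, in semantic form. -/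
structure SetAxioms {M : Type u} (E : M → M → Prop) : Prop where
  ext : ∀ x y, (∀ z, E z x ↔ E z y) → x = y
  pairing : ∀ x y, ∃ p, ∀ z, E z p ↔ z = x ∨ z = y
  union : ∀ a, ∃ b, ∀ x, E x b ↔ ∃ y, E y a ∧ E x y
  powerSet : ∀ a, ∃ b, ∀ x, E x b ↔ ∀ y, E y x → E y a
  infinity : ∃ a, (∃ e, E e a ∧ ∀ x, ¬ E x e) ∧
    ∀ x, E x a → ∃ y, E y a ∧ ∀ z, E z y ↔ E z x ∨ z = x
  choice : ∀ a, (∀ x, E x a → ∃ y, E y x) →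
    (∀ x y, E x a → E y a → (∃ z, E z x ∧ E z y) → x = y) →
    ∃ c, ∀ x, E x a → ∃ z, ∀ w, E w c ∧ E w x ↔ w = z
  separation : ∀ P : M → Prop, Dfn E (fun v : Fin 1 → M => P (v 0)) →
    ∀ a, ∃ b, ∀ x, E x b ↔ E x a ∧ P x
  replacement : ∀ R : M → M → Prop, Dfn E (fun v : Fin 2 → M => R (v 0) (v 1)) →
    ∀ a, (∀ x y z, E x a → R x y → R x z → y = z) → ∃ b, ∀ y, E y b ↔ ∃ x, E x a ∧ R x y

theorem models_iff_setAxioms {M : Type u} [setLang.Structure M] :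
    M ⊨ ZFCWithoutFoundation ↔ SetAxioms (Mem : M → M → Prop) := by
  constructor
  · intro h
    have h' : ∀ σ ∈ ZFCWithoutFoundation, M ⊨ σ := fun σ hσ => h.realize_of_mem σ hσ
    refine ⟨realize_extensionality.1 (h' _ ?_), realize_pairing.1 (h' _ ?_),
      realize_union.1 (h' _ ?_), realize_powerSet.1 (h' _ ?_), realize_infinity.1 (h' _ ?_),
      realize_choice.1 (h' _ ?_), fun P hP a => ?_, fun R hR a ha => ?_⟩
    iterate 6 exact .inl (.inl (by simp))
    · obtain ⟨k, p, φ, hφ⟩ := hP.exists_formula_params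
      obtain ⟨b, hb⟩ := (realize_separation φ).1 (h' _ (.inl (.inr ⟨_, _, rfl⟩))) p a
      exact ⟨b, fun x => by rw [hb, hφ]; rfl⟩
    · obtain ⟨k, p, φ, hφ⟩ := hR.exists_formula_params
      simpa only [hφ] using! (realize_replacement φ).1 (h' _ (.inr ⟨_, _, rfl⟩)) p a
        (by simpa only [hφ] using! ha)
  · intro h
    refine ⟨?_⟩
    rintro σ ((hσ | ⟨n, φ, rfl⟩) | ⟨n, φ, rfl⟩)
    · rcases hσ with rfl | rfl | rfl | rfl | rfl | rfl
      exacts [realize_extensionality.2 h.ext, realize_pairing.2 h.pairing,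
        realize_union.2 h.union, realize_powerSet.2 h.powerSet, realize_infinity.2 h.infinity,
        realize_choice.2 h.choice]
    · refine (realize_separation φ).2 fun p a => h.separation _ ?_ a
      convert dfn_formula φ p using 4 with v
      ext i; fin_cases i; rfl
    · refine (realize_replacement φ).2 fun p a => h.replacement _ ?_ a
      convert dfn_formula φ p using 4 with v
      ext i; fin_cases i <;> rfl

/-- A function of `n`-tuples that is a coordinate or a constant. -/
def IsTerm {M : Type u} {n : ℕ} (t : (Fin n → M) → M) : Prop :=
  ∃ s : M ⊕ Fin n, t = fun v => Sum.elim id v s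

section Dfn

variable {M : Type u} {E : M → M → Prop} {n : ℕ}

theorem IsTerm.const (c : M) : IsTerm (fun _ : Fin n → M => c) := ⟨.inl c, rfl⟩

theorem IsTerm.var (i : Fin n) : IsTerm (fun v : Fin n → M => v i) := ⟨.inr i, rfl⟩

theorem IsTerm.last : IsTerm (fun v : Fin (n + 1) → M => v (Fin.last n)) := .var _

theorem IsTerm.init {t : (Fin n → M) → M} (ht : IsTerm t) :
    IsTerm (fun v : Fin (n + 1) → M => t (Fin.init v)) := by
  obtain ⟨s | i, rfl⟩ := ht
  exacts [.const s, .var i.castSucc]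

variable {P Q : (Fin n → M) → Prop} {s t : (Fin n → M) → M}

theorem Dfn.eq (hs : IsTerm s) (ht : IsTerm t) : Dfn E (fun v => s v = t v) := by
  obtain ⟨s, rfl⟩ := hs
  obtain ⟨t, rfl⟩ := ht
  exact .eq' s t

theorem Dfn.mem (hs : IsTerm s) (ht : IsTerm t) : Dfn E (fun v => E (s v) (t v)) := by
  obtain ⟨s, rfl⟩ := hs
  obtain ⟨t, rfl⟩ := ht
  exact .mem' s t

theorem Dfn.congr (hP : Dfn E P) (h : ∀ v, P v ↔ Q v) : Dfn E Q :=
  funext (fun v => propext (h v)) ▸ hP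

theorem Dfn.not (hP : Dfn E P) : Dfn E (fun v => ¬ P v) := .imp hP .false

theorem Dfn.or (hP : Dfn E P) (hQ : Dfn E Q) : Dfn E (fun v => P v ∨ Q v) :=
  (Dfn.imp hP.not hQ).congr fun _ => or_iff_not_imp_left.symm

theorem Dfn.and (hP : Dfn E P) (hQ : Dfn E Q) : Dfn E (fun v => P v ∧ Q v) :=
  (Dfn.imp hP hQ.not).not.congr fun _ => by tauto

theorem Dfn.iff (hP : Dfn E P) (hQ : Dfn E Q) : Dfn E (fun v => P v ↔ Q v) :=
  ((Dfn.imp hP hQ).and (.imp hQ hP)).congr fun _ => iff_iff_implies_and_implies.symm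

theorem Dfn.all {R : (Fin n → M) → M → Prop}
    (h : Dfn E (fun v : Fin (n + 1) → M => R (Fin.init v) (v (Fin.last n)))) :
    Dfn E (fun v => ∀ x, R v x) :=
  (Dfn.all' h).congr fun v => by simp

theorem Dfn.ex {R : (Fin n → M) → M → Prop}
    (h : Dfn E (fun v : Fin (n + 1) → M => R (Fin.init v) (v (Fin.last n)))) :
    Dfn E (fun v => ∃ x, R v x) :=
  (Dfn.all (R := fun v x => ¬ R v x) h.not).not.congr fun v => by simp

/-- Definability in a structure whose membership relation is definable in `(M, E)`. -/
theorem Dfn.of_rel {E' : M → M → Prop} (hP : Dfn E' P)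
    (hE : ∀ {n : ℕ} {s t : (Fin n → M) → M}, IsTerm s → IsTerm t →
      Dfn E (fun v => E' (s v) (t v))) : Dfn E P := by
  induction hP with
  | false => exact .false
  | eq' s t => exact .eq' s t
  | mem' s t => exact hE ⟨s, rfl⟩ ⟨t, rfl⟩
  | imp _ _ ih₁ ih₂ => exact .imp ih₁ ih₂
  | all' _ ih => exact .all' ih

end Dfn

/-! ### Twisted membership and consequences of the axioms -/

namespace SetAxioms

variable {M : Type u} {E : M → M → Prop}

/-- Twisting the membership relation by a definable involution that fixes the elements of some
inductive set preserves the axioms of ZFC without Foundation. -/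
theorem twist (h : SetAxioms E) {π : M → M} (hπ : Function.Involutive π)
    (hdef : ∀ {n : ℕ} {s t : (Fin n → M) → M}, IsTerm s → IsTerm t →
      Dfn E (fun v => π (s v) = t v))
    (hinf : ∃ a, (∃ e, E e a ∧ ∀ x, ¬ E x e) ∧
      (∀ x, E x a → ∃ y, E y a ∧ ∀ z, E z y ↔ E z x ∨ z = x) ∧ ∀ x, E x a → π x = x) :
    SetAxioms (fun x y => E x (π y)) := by
  have hE : ∀ {n : ℕ} {s t : (Fin n → M) → M}, IsTerm s → IsTerm t →
      Dfn E (fun v => E (s v) (π (t v))) := fun {n s t} hs ht =>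
    (Dfn.ex (R := fun v y => π (t v) = y ∧ E (s v) y)
      ((hdef ht.init .last).and (.mem hs.init .last))).congr fun v => by simp
  -- The `π`-image of a set is a set, by Replacement; as `π` is an involution, it is also the
  -- preimage.
  have image : ∀ a, ∃ b, ∀ y, E y b ↔ E (π y) a := by
    intro a
    obtain ⟨b, hb⟩ := h.replacement (fun x y => π x = y) (hdef (.var 0) (.var 1)) a
      (fun x y z _ hy hz => hy.symm.trans hz)
    refine ⟨b, fun y => (hb y).trans ⟨?_, fun hy => ⟨_, hy, hπ y⟩⟩⟩
    rintro ⟨x, hx, rfl⟩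
    rwa [hπ]
  -- Both relations have the same extensions: what `b` collects in the old sense, `π b` collects in
  -- the new one.
  have code : ∀ {S : M → Prop}, (∃ b, ∀ x, E x b ↔ S x) → ∃ b, ∀ x, E x (π b) ↔ S x :=
    fun ⟨b, hb⟩ => ⟨π b, by rwa [hπ]⟩
  refine ⟨fun x y hxy => hπ.injective (h.ext _ _ hxy), fun x y => code (h.pairing x y),
    fun a => code ?_, fun a => code ?_, ?_, fun a hne hdis => ?_,
    fun P hP a => code (h.separation P (hP.of_rel hE) _),
    fun R hR a ha => code (h.replacement R (hR.of_rel hE) _ ha)⟩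
  · obtain ⟨b, hb⟩ := image (π a)
    obtain ⟨c, hc⟩ := h.union b
    refine ⟨c, fun x => (hc x).trans ⟨?_, ?_⟩⟩
    · rintro ⟨y, hy, hx⟩
      exact ⟨π y, (hb y).1 hy, by rwa [hπ]⟩
    · rintro ⟨y, hy, hx⟩
      exact ⟨π y, (hb _).2 (by rwa [hπ]), hx⟩
  -- In the new sense `x ⊆ a` means `π x ⊆ π a`, so the power set is pulled back along `π`.
  · obtain ⟨b, hb⟩ := h.powerSet (π a)
    obtain ⟨c, hc⟩ := image b
    exact ⟨c, fun x => (hc x).trans (hb _)⟩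
  · obtain ⟨a, ⟨e, he, hemp⟩, hsucc, hfix⟩ := hinf
    refine ⟨π a, ⟨e, by rwa [hπ], by rwa [hfix e he]⟩, fun x hx => ?_⟩
    rw [hπ] at hx
    obtain ⟨y, hy, hyx⟩ := hsucc x hx
    exact ⟨y, by rwa [hπ], by rwa [hfix y hy, hfix x hx]⟩
  -- The new members of `a`, read in the old sense, form the family `π '' (π a)`; an old transversal
  -- of it is used.
  · obtain ⟨b, hb⟩ := image (π a)
    obtain ⟨c, hc⟩ := h.choice b (fun x hx => by simpa [hπ x] using hne _ ((hb x).1 hx))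
      (fun x y hx hy hxy => hπ.injective
        (hdis _ _ ((hb x).1 hx) ((hb y).1 hy) (by simpa only [hπ x, hπ y] using hxy)))
    refine ⟨π c, fun x hx => ?_⟩
    rw [hπ]
    exact hc (π x) ((hb _).2 (by rwa [hπ]))

/-- Every finite collection of elements is a set. -/
theorem exists_of_finite (h : SetAxioms E) {S : Set M} (hS : S.Finite) :
    ∃ b, ∀ x, E x b ↔ x ∈ S := by
  induction S, hS using Set.Finite.induction_on with
  | empty =>
    obtain ⟨-, ⟨e, -, he⟩, -⟩ := h.infinity
    exact ⟨e, by simpa using he⟩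
  | @insert a S _ _ ih =>
    obtain ⟨b, hb⟩ := ih
    obtain ⟨s, hs⟩ := h.pairing a a
    obtain ⟨p, hp⟩ := h.pairing s b
    obtain ⟨c, hc⟩ := h.union p
    refine ⟨c, fun x => ?_⟩
    simp [hc, hp, hs, hb]

/-- Foundation forbids finite cycles of the membership relation. -/
theorem not_transGen_self (h : SetAxioms E)
    (hf : ∀ a, (∃ x, E x a) → ∃ x, E x a ∧ ∀ y, E y x → ¬ E y a) (x : M) :
    ¬ Relation.TransGen E x x := by
  -- `S` collects the points of the path before `y`. When `y = x` every point of `S` has a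
  -- predecessor in `S`, and `S`, being finite, is a set of the model, against Foundation.
  have key : ∀ y, Relation.TransGen E x y → ∃ S : Set M, S.Finite ∧ (∃ z ∈ S, E z y) ∧
      ∀ w ∈ S, w = x ∨ ∃ z ∈ S, E z w := by
    intro y hy
    induction hy with
    | single hy => exact ⟨{x}, by simp, by simpa using hy, by simp⟩
    | @tail b c _ hbc ih =>
      obtain ⟨S, hS, ⟨z, hz, hzb⟩, hpred⟩ := ih
      refine ⟨insert b S, hS.insert b, ⟨b, by simp, hbc⟩, ?_⟩
      rintro w (rfl | hw)
      · exact .inr ⟨z, .inr hz, hzb⟩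
      · exact (hpred w hw).imp id fun ⟨u, hu, huw⟩ => ⟨u, .inr hu, huw⟩
  intro hx
  obtain ⟨S, hS, ⟨z, hz, hzx⟩, hpred⟩ := key x hx
  obtain ⟨b, hb⟩ := h.exists_of_finite hS
  obtain ⟨w, hw, hmin⟩ := hf b ⟨z, (hb z).2 hz⟩
  rcases hpred w ((hb w).1 hw) with rfl | ⟨u, hu, huw⟩
  · exact hmin z hzx ((hb z).2 hz)
  · exact hmin u huw ((hb u).2 hu)

/-- Foundation makes the universe infinite. -/
theorem infinite (h : SetAxioms E)
    (hf : ∀ a, (∃ x, E x a) → ∃ x, E x a ∧ ∀ y, E y x → ¬ E y a) : Infinite M := by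
  refine not_finite_iff_infinite.1 fun _ => ?_
  obtain ⟨b, hb⟩ := h.exists_of_finite (Set.finite_univ (α := M))
  exact h.not_transGen_self hf b (.single ((hb b).2 trivial))

/-- An inductive set all of whose elements are transitive. -/
theorem exists_inductive_transitive (h : SetAxioms E) :
    ∃ a, (∃ e, E e a ∧ ∀ x, ¬ E x e) ∧
      (∀ x, E x a → ∃ y, E y a ∧ ∀ z, E z y ↔ E z x ∨ z = x) ∧
      ∀ x, E x a → ∀ y, E y x → ∀ z, E z y → E z x := by
  obtain ⟨a, ⟨e, he, hemp⟩, hsucc⟩ := h.infinity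
  obtain ⟨b, hb⟩ := h.separation (fun x => ∀ y, E y x → ∀ z, E z y → E z x)
    (.all (R := fun v y => E y (v 0) → ∀ z, E z y → E z (v 0))
      (.imp (.mem .last (IsTerm.var 0).init)
        (.all (R := fun v z => E z (v 1) → E z (v 0))
          (.imp (.mem .last (IsTerm.var 1).init) (.mem .last (IsTerm.var 0).init))))) a
  refine ⟨b, ⟨e, (hb e).2 ⟨he, fun y hy => (hemp y hy).elim⟩, hemp⟩, fun x hx => ?_,
    fun x hx => ((hb x).1 hx).2⟩
  obtain ⟨hxa, hx⟩ := (hb x).1 hx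
  obtain ⟨y, hy, hyx⟩ := hsucc x hxa
  refine ⟨y, (hb y).2 ⟨hy, fun u hu z hz => (hyx z).2 (.inl ?_)⟩, hyx⟩
  rcases (hyx u).1 hu with hu | rfl
  exacts [hx u hu z hz, hz]

end SetAxioms

/-! ### The involution coding the graph -/

variable {M : Type u}

/-- A definable involution such that the double-membership graph of the twisted structure is
isomorphic, through `A`, to the given graph on `V` together with isolated vertices. -/
theorem SetAxioms.exists_involution {E : M → M → Prop} (h : SetAxioms E)
    (hf : ∀ a, (∃ x, E x a) → ∃ x, E x a ∧ ∀ y, E y x → ¬ E y a) (V : M) {adj : M → M → Prop}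
    (hsymm : ∀ x y, adj x y → adj y x)
    (hadj : ∀ {n : ℕ} {s t : (Fin n → M) → M}, IsTerm s → IsTerm t →
      Dfn E (fun v => adj (s v) (t v))) :
    ∃ π A : M → M, Function.Involutive π ∧
      (∀ {n : ℕ} {s t : (Fin n → M) → M}, IsTerm s → IsTerm t → Dfn E (fun v => π (s v) = t v)) ∧
      (∀ x, (∀ y, E y x → ∀ z, E z y → E z x) → π x = x) ∧
      (∀ v w, A v = A w → v = w) ∧
      (∀ x y, (E x (π y) ∧ E y (π x)) ↔
        ∃ v w, E v V ∧ E w V ∧ adj v w ∧ x = A v ∧ y = A w) ∧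
      Infinite {x : M // ∀ v, E v V → x ≠ A v} := by
  have irr := h.not_transGen_self hf
  have irrefl : ∀ x, ¬ E x x := fun x hx => irr x (.single hx)
  choose pr hpr using h.pairing
  have defpr : ∀ {n : ℕ} {s t r : (Fin n → M) → M}, IsTerm s → IsTerm t → IsTerm r →
      Dfn E (fun v => r v = pr (s v) (t v)) := fun {n s t r} hs ht hr =>
    (Dfn.all (R := fun v z => E z (r v) ↔ (z = s v ∨ z = t v))
      (.iff (.mem .last hr.init) (.or (.eq .last hs.init) (.eq .last ht.init)))).congr fun v =>
      ⟨fun hv => h.ext _ _ fun z => by rw [hv, hpr], fun hv z => by rw [hv, hpr]⟩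
  have sing : ∀ x y z, pr x x = pr y z → x = y ∧ x = z := fun x y z e =>
    ⟨(by simpa [e, hpr] using hpr x x y : y = x).symm,
      (by simpa [e, hpr] using hpr x x z : z = x).symm⟩
  -- The chain `v ∈ V ∈ d ∈ c` puts `c` above every vertex.
  obtain ⟨d, hd⟩ : ∃ d, d = pr V V := ⟨_, rfl⟩
  obtain ⟨c, hc⟩ : ∃ c, c = pr d d := ⟨_, rfl⟩
  have hVd : E V d := by simp [hd, hpr]
  have hdc : E d c := by simp [hc, hpr]
  obtain ⟨A, hA⟩ : ∃ A : M → M, ∀ v, A v = pr c v := ⟨_, fun _ => rfl⟩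
  obtain ⟨S, hS⟩ : ∃ S : M → M, ∀ v, S v = pr (A v) (A v) := ⟨_, fun _ => rfl⟩
  obtain ⟨T, hT⟩ : ∃ T : M → M, ∀ v, T v = pr (S v) (S v) := ⟨_, fun _ => rfl⟩
  have memA : ∀ z v, E z (A v) ↔ z = c ∨ z = v := fun z v => by rw [hA, hpr]
  have memS : ∀ z v, E z (S v) ↔ z = A v := fun z v => by rw [hS, hpr, or_self]
  have memT : ∀ z v, E z (T v) ↔ z = S v := fun z v => by rw [hT, hpr, or_self]
  have defA : ∀ {n : ℕ} {s t : (Fin n → M) → M}, IsTerm s → IsTerm t →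
      Dfn E (fun v => t v = A (s v)) := fun hs ht => by
    simp only [hA]
    exact defpr (.const c) hs ht
  have defT : ∀ {n : ℕ} {s t : (Fin n → M) → M}, IsTerm s → IsTerm t →
      Dfn E (fun v => t v = T (s v)) := fun {n s t} hs ht =>
    (Dfn.ex (R := fun v a => a = A (s v) ∧ ∃ b, b = pr a a ∧ t v = pr b b)
      ((defA hs.init .last).and
        (.ex (R := fun v b => b = pr (v (Fin.last n)) (v (Fin.last n)) ∧ t (Fin.init v) = pr b b)
          ((defpr IsTerm.last.init IsTerm.last.init .last).and
            (defpr .last .last ht.init.init))))).congr fun v => by simp [hT, hS]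
  have exB : ∀ v, ∃ b, ∀ z, E z b ↔ (∃ w, E w V ∧ adj w v ∧ z = A w) ∨ z = T v := by
    intro v
    obtain ⟨b, hb⟩ := h.replacement (fun w z => adj w v ∧ z = A w)
      ((hadj (.var 0) (.const v)).and (defA (.var 0) (.var 1))) V
      (fun w y z _ hy hz => hy.2.trans hz.2.symm)
    obtain ⟨b', hb'⟩ := h.union (pr b (pr (T v) (T v)))
    exact ⟨b', fun z => by simp [hb', hpr, hb]⟩
  choose B memB using exB
  have defB : ∀ {n : ℕ} {s t : (Fin n → M) → M}, IsTerm s → IsTerm t →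
      Dfn E (fun v => t v = B (s v)) := fun {n s t} hs ht =>
    (Dfn.all (R := fun v z => E z (t v) ↔ (∃ w, E w V ∧ adj w (s v) ∧ z = A w) ∨ z = T (s v))
      (.iff (.mem .last ht.init) (.or
        (.ex (R := fun v w => E w V ∧ adj w (s (Fin.init v)) ∧ v (Fin.last n) = A w)
          ((Dfn.mem .last (.const V)).and
            ((hadj .last hs.init.init).and (defA .last IsTerm.last.init))))
        (defT hs.init .last)))).congr fun v =>
      ⟨fun hv => h.ext _ _ fun z => by rw [hv, memB], fun hv z => by rw [hv, memB]⟩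
  have cA : ∀ v, E c (A v) := fun v => (memA _ _).2 (.inl rfl)
  have AS : ∀ v, E (A v) (S v) := fun v => (memS _ _).2 rfl
  have ST : ∀ v, E (S v) (T v) := fun v => (memT _ _).2 rfl
  have TB : ∀ v, E (T v) (B v) := fun v => (memB _ _).2 (.inr rfl)
  have cS : ∀ v, Relation.TransGen E c (S v) := fun v => .tail (.single (cA v)) (AS v)
  have cT : ∀ v, Relation.TransGen E c (T v) := fun v => .tail (cS v) (ST v)
  have cB : ∀ v, Relation.TransGen E c (B v) := fun v => .tail (cT v) (TB v)
  -- A member of `A v` is `c` or `v`; if `c` lay below it, a cycle through `c` would close up.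
  have high : ∀ z v, Relation.TransGen E c z → E v V → ¬ E z (A v) := by
    intro z v hz hv hzv
    rcases (memA _ _).1 hzv with rfl | rfl
    · exact irr _ hz
    · exact irr _ (((hz.tail hv).tail hVd).tail hdc)
  have injA : ∀ v w, A v = A w → v = w := by
    intro v w e
    have h₁ := (memA v w).1 (e ▸ (memA v v).2 (.inr rfl))
    have h₂ := (memA w v).1 (e ▸ (memA w w).2 (.inr rfl))
    rcases h₁ with rfl | h₁
    · rcases h₂ with h₂ | h₂ <;> exact h₂.symm
    · exact h₁
  have AT : ∀ v w, A v ≠ T w := fun v w e => by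
    have hc' := (memT c w).1 (e ▸ cA v)
    exact irr c (by simpa only [← hc'] using cS w)
  have AB : ∀ v w, E v V → A v ≠ B w := fun v w hv e => high _ v (cT w) hv (e ▸ TB w)
  have injB : ∀ v w, B v = B w → v = w := by
    intro v w e
    rcases (memB w _).1 (e ▸ TB v) with ⟨u, -, -, hu⟩ | e'
    · exact (AT _ _ hu.symm).elim
    · rw [hT, hT] at e'
      have e'' := (sing _ _ _ e').1
      rw [hS, hS] at e''
      exact injA _ _ (sing _ _ _ e'').1
  -- The witness is `d ∈ c ∈ A v`: transitivity would force `d = c` or `d = v ∈ V`.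
  have transA : ∀ v, E v V → ¬ ∀ y, E y (A v) → ∀ z, E z y → E z (A v) := by
    intro v hv ht
    rcases (memA d v).1 (ht c (cA v) d hdc) with e | rfl
    · exact irrefl c (e ▸ hdc)
    · exact irr V ((Relation.TransGen.single hVd).tail hv)
  -- The witness is `S v ∈ T v ∈ B v`; but `S v` is neither some `A w` nor `T v`.
  have transB : ∀ v, ¬ ∀ y, E y (B v) → ∀ z, E z y → E z (B v) := by
    intro v ht
    rcases (memB v _).1 (ht _ (TB v) _ (ST v)) with ⟨w, -, -, e⟩ | e
    · have hc' := (memS c v).1 (e ▸ cA w)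
      exact irrefl c (by simpa only [← hc'] using cA v)
    · exact irrefl (T v) (by simpa only [e] using ST v)
  let Sw : M → M → Prop := fun x y => ∃ v, E v V ∧ x = A v ∧ y = B v
  have defSw : ∀ {n : ℕ} {s t : (Fin n → M) → M}, IsTerm s → IsTerm t →
      Dfn E (fun v => Sw (s v) (t v)) := fun {n s t} hs ht =>
    .ex (R := fun v u => E u V ∧ s v = A u ∧ t v = B u)
      ((Dfn.mem .last (.const V)).and ((defA .last hs.init).and (defB .last ht.init)))
  -- The graph of `π`, introduced as a relation so that its definability is visible before `π` is
  -- chosen.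
  let R : M → M → Prop := fun x y =>
    (Sw x y ∨ Sw y x) ∨ (y = x ∧ ∀ z, ¬ Sw x z ∧ ¬ Sw z x)
  have exR : ∀ x, ∃ y, R x y := by
    intro x
    by_cases hx : ∃ z, Sw x z ∨ Sw z x
    · exact hx.imp fun _ => .inl
    · exact ⟨x, .inr ⟨rfl, by simpa only [not_exists, not_or] using hx⟩⟩
  have symR : ∀ x y, R x y → R y x := by
    rintro x y (hxy | ⟨rfl, hxy⟩)
    exacts [.inl hxy.symm, .inr ⟨rfl, hxy⟩]
  have funR : ∀ x y z, R x y → R x z → y = z := by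
    rintro x y z ((⟨v, hv, rfl, rfl⟩ | ⟨v, hv, rfl, rfl⟩) | ⟨rfl, hy⟩)
      ((⟨w, hw, e, rfl⟩ | ⟨w, hw, rfl, e⟩) | ⟨rfl, hz⟩)
    · rw [injA _ _ e]
    · exact (AB _ _ hv e).elim
    · exact ((hz _).1 ⟨v, hv, rfl, rfl⟩).elim
    · exact (AB _ _ hw e.symm).elim
    · rw [injB _ _ e]
    · exact ((hz _).2 ⟨v, hv, rfl, rfl⟩).elim
    · exact ((hy _).1 ⟨w, hw, e, rfl⟩).elim
    · exact ((hy _).2 ⟨w, hw, rfl, e⟩).elim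
    · rfl
  choose π hπ using exR
  have eqπ : ∀ x y, π x = y ↔ R x y := fun x y =>
    ⟨fun e => e ▸ hπ x, fun hxy => funR x _ _ (hπ x) hxy⟩
  have πA : ∀ v, E v V → π (A v) = B v := fun v hv => (eqπ _ _).2 (.inl (.inl ⟨v, hv, rfl, rfl⟩))
  have πB : ∀ v, E v V → π (B v) = A v := fun v hv => (eqπ _ _).2 (.inl (.inr ⟨v, hv, rfl, rfl⟩))
  have tri : ∀ x, π x = x ∨ (∃ v, E v V ∧ x = A v) ∨ ∃ v, E v V ∧ x = B v := by
    intro x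
    rcases hπ x with (⟨v, hv, e, -⟩ | ⟨v, hv, -, e⟩) | ⟨e, -⟩
    exacts [.inr (.inl ⟨v, hv, e⟩), .inr (.inr ⟨v, hv, e⟩), .inl e]
  have fixA : ∀ y v, π y = y → E v V → E (A v) y → ¬ E y (B v) := by
    intro y v hy hv hvy hyv
    rcases (memB _ _).1 hyv with ⟨w, hw, -, rfl⟩ | rfl
    · exact AB w w hw (hy.symm.trans (πA w hw))
    · have e := (memT _ _).1 hvy
      exact irrefl (S v) (by simpa only [e] using AS v)
  refine ⟨π, A, fun x => (eqπ _ _).2 (symR _ _ (hπ x)), fun {n s t} hs ht => ?_, fun x hx => ?_,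
    injA, fun x y => ⟨?_, ?_⟩, ?_⟩
  · refine Dfn.congr (.or (.or (defSw hs ht) (defSw ht hs)) (.and (.eq ht hs)
      (.all (R := fun v z => ¬ Sw (s v) z ∧ ¬ Sw z (s v))
        (.and (defSw hs.init .last).not (defSw .last hs.init).not)))) fun v => (eqπ _ _).symm
  · rcases tri x with hx' | ⟨v, hv, rfl⟩ | ⟨v, hv, rfl⟩
    exacts [hx', (transA v hv hx).elim, (transB v hx).elim]
  · rintro ⟨hxy, hyx⟩
    -- Of the nine cases only `x = A v`, `y = A w` survives. Two fixed points give a 2-cycle, a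
    -- fixed point with some `A v` contradicts `fixA`, and every case involving some `B v`
    -- contradicts `high`.
    rcases tri x with hx | ⟨v, hv, rfl⟩ | ⟨v, hv, rfl⟩ <;>
      rcases tri y with hy | ⟨w, hw, rfl⟩ | ⟨w, hw, rfl⟩
    · rw [hy] at hxy
      rw [hx] at hyx
      exact (irr x ((Relation.TransGen.single hxy).tail hyx)).elim
    · rw [πA w hw] at hxy
      rw [hx] at hyx
      exact (fixA x w hx hw hyx hxy).elim
    · rw [πB w hw] at hxy
      rw [hx] at hyx
      exact (high _ _ ((cB w).tail hyx) hw hxy).elim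
    · rw [πA v hv] at hyx
      rw [hy] at hxy
      exact (fixA y v hy hv hxy hyx).elim
    · rw [πA w hw] at hxy
      rcases (memB _ _).1 hxy with ⟨u, -, huw, e⟩ | e
      · rw [← injA _ _ e] at huw
        exact ⟨v, w, hv, hw, huw, rfl, rfl⟩
      · exact (AT _ _ e).elim
    · rw [πB w hw] at hxy
      exact (high _ _ (.single (cA v)) hw hxy).elim
    · rw [πB v hv] at hyx
      rw [hy] at hxy
      exact (high _ _ ((cB v).tail hxy) hv hyx).elim
    · rw [πB v hv] at hyx
      exact (high _ _ (.single (cA w)) hv hyx).elim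
    · rw [πB v hv] at hyx
      exact (high _ _ (cB w) hv hyx).elim
  · rintro ⟨v, w, hv, hw, hvw, rfl, rfl⟩
    rw [πA v hv, πA w hw]
    exact ⟨(memB _ _).2 (.inl ⟨v, hv, hvw, rfl⟩), (memB _ _).2 (.inl ⟨w, hw, hsymm _ _ hvw, rfl⟩)⟩
  -- Singletons supply infinitely many isolated vertices: `{x} = {c, v}` would give `c = v ∈ V`,
  -- hence the cycle `V ∈ d ∈ c ∈ V`.
  · have := h.infinite hf
    refine Infinite.of_injective (fun x => ⟨pr x x, fun v hv e => ?_⟩) fun x y e =>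
      (sing _ _ _ (Subtype.ext_iff.1 e)).1
    rw [hA] at e
    obtain ⟨rfl, rfl⟩ := sing _ _ _ e
    exact irr V (((Relation.TransGen.single hVd).tail hdc).tail hv)

/-! ### Assembling the model -/

section Model

variable [setLang.Structure M]

theorem dfn_isPair {n : ℕ} {s x y : (Fin n → M) → M} (hs : IsTerm s) (hx : IsTerm x)
    (hy : IsTerm y) : Dfn Mem (fun v => IsPair (s v) (x v) (y v)) :=
  .all (R := fun v z => Mem z (s v) ↔ z = x v ∨ z = y v)
    (.iff (.mem .last hs.init) (.or (.eq .last hx.init) (.eq .last hy.init)))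

theorem dfn_isOrderedPair {n : ℕ} {p x y : (Fin n → M) → M} (hp : IsTerm p) (hx : IsTerm x)
    (hy : IsTerm y) : Dfn Mem (fun v => IsOrderedPair (p v) (x v) (y v)) :=
  .all (R := fun v z => Mem z (p v) ↔ IsPair z (x v) (x v) ∨ IsPair z (x v) (y v))
    (.iff (.mem .last hp.init)
      (.or (dfn_isPair .last hx.init hx.init) (dfn_isPair .last hx.init hy.init)))

end Model

/-- The structure for the language of set theory given by a binary relation. -/
abbrev structureOf (E : M → M → Prop) : setLang.Structure M where
  funMap f := f.elim
  RelMap | .mem, v => E (v 0) (v 1)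

end DoubleMembership

theorem mainTheorem9 (M : Type u) [DoubleMembership.setLang.Structure M]
    (hM : M ⊨ DoubleMembership.ZFC) (G : DoubleMembership.InternalGraph M) :
    ∃ (N : Type u) (_ : DoubleMembership.setLang.Structure N),
      N ⊨ DoubleMembership.ZFCWithoutFoundation ∧
      ∃ I : Type u, Infinite I ∧
        (DoubleMembership.dGraph N).Iso (G.toGraph.addIsolated I) := by
  open DoubleMembership in
  have hf := realize_foundation.1 (hM.realize_of_mem foundation (.inl rfl))
  have h := models_iff_setAxioms.1 (hM.mono (Set.subset_insert foundation ZFCWithoutFoundation))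
  obtain ⟨π, A, hπ, hdef, hfix, hinj, hadj, hinf⟩ := h.exists_involution hf G.dom
    (adj := fun x y => ∃ p, Mem p G.edges ∧ IsOrderedPair p x y) G.edges_symm
    (fun {n s t} hs ht => .ex (R := fun v p => Mem p G.edges ∧ IsOrderedPair p (s v) (t v))
      (.and (.mem .last (.const _)) (dfn_isOrderedPair .last hs.init ht.init)))
  -- The isolated part is the complement of the image of the vertex set under `A`; the isomorphism,
  -- built from the graph side, is `A` on vertices and the inclusion on that complement.
  refine ⟨M, structureOf fun x y => Mem x (π y), ?_, _, hinf, ⟨RelIso.symm ⟨.ofBijective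
    (Sum.elim (fun v => A v.1) Subtype.val) ⟨?_, fun x => ?_⟩, ?_⟩⟩⟩
  · obtain ⟨a, he, hsucc, htrans⟩ := h.exists_inductive_transitive
    exact (@models_iff_setAxioms M (structureOf fun x y => Mem x (π y))).2
      (h.twist hπ hdef ⟨a, he, hsucc, fun x hx => hfix x (htrans x hx)⟩)
  · refine Function.Injective.sumElim (fun v w e => Subtype.ext (hinj _ _ e))
      Subtype.val_injective fun v x e => x.2 v.1 v.2 e.symm
  · by_cases hx : ∃ v, Mem v G.dom ∧ x = A v
    · obtain ⟨v, hv, rfl⟩ := hx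
      exact ⟨.inl ⟨v, hv⟩, rfl⟩
    · exact ⟨.inr ⟨x, fun v hv e => hx ⟨v, hv, e⟩⟩, rfl⟩
  · intro x y
    refine (hadj _ _).trans ⟨?_, ?_⟩
    · rintro ⟨v, w, hv, hw, hvw, hx, hy⟩
      rcases x with x | x
      · rcases y with y | y
        · refine .inl ?_
          obtain rfl := hinj _ _ hx
          obtain rfl := hinj _ _ hy
          exact hvw
        · exact (y.2 w hw hy).elim
      · exact (x.2 v hv hx).elim
    · rintro (@⟨v, w, hxy⟩ | hxy)
      · exact ⟨v, w, v.2, w.2, hxy, rfl, rfl⟩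
      · exact hxy.elim
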